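/- **Setting.** Let $\mathcal H$ be a complex Hilbert space and let $\varphi$ be a bounded linear operator on $\mathcal H$ that is *finite potent*, i.e. $\varphi^n(\mathcal H)$ is finite-dimensional for some $n$. An *AST-decomposition* of a vector space $V$ for $f\in\operatorname{End}(V)$ is a decomposition $V=W\oplus U$ into $f$-invariant subspaces such that $f|_U$ is nilpotent, $W$ is finite-dimensional and $f|_W$ is an automorphism of $W$. Put $$U_\varphi=\{v: \varphi^m(v)=0\text{ for some }m\},\qquad W_\varphi=\{v: p(\varphi)(v)=0\text{ for some }p\in\mathbb C[x]\text{ relatively prime to }x\}.$$ *Tate's trace.* $\operatorname{tr}_V(f)$ is defined for finite potent endomorphisms $f$ of arbitrary $\mathbb C$-vector spaces $V$ by the properties: (1) it is the ordinary trace if $V$ is finite-dimensional; (2) $\operatorname{tr}_V(f)=\operatorname{tr}_W(f|_W)+\operatorname{tr}_{V/W}(\bar f)$ for every $f$-invariant subspace $W\subseteq V$, where $\bar f$ is the induced endomorphism of $V/W$; (3) $\operatorname{tr}_V(f)=0$ if $f$ is nilpotent. *Leray trace.* With $N(f)=\bigcup_{s\ge1}\ker f^s$, if $V/N(f)$ is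 finite-dimensional then $\operatorname{tr}^L_V(f)$ is the ordinary trace of the endomorphism of $V/N(f)$ induced by $f$. *Riesz trace.* A bounded operator $T$ on $\mathcal H$ is a *Riesz operator* if for every non-zero $\lambda\in\sigma(T)$ there is an algebraic direct sum decomposition $\mathcal H=N\oplus F$ into $T$-invariant subspaces with $N$ finite-dimensional, $F$ closed, $T-\lambda$ nilpotent on $N$, and $T-\lambda$ a homeomorphism of $F$ onto $F$. A *West decomposition* of $T$ is $T=T_C+T_Q$ with $T_C$ compact, $T_Q$ bounded and quasinilpotent ($\sigma(T_Q)\subseteq\{0\}$), and $T_CT_Q=T_QT_C=0$. A compact operator $C$ is of *trace class* if $\sum_{i}\langle |C|u_i,u_i\rangle<\infty$ for orthonormal bases $(u_i)$, where $|C|=(C^*C)^{1/2}$ (equivalently, its singular values are summable), and then its trace is $\operatorname{tr}(C)=\sum_i\langle Cu_i,u_i\rangle$ for any orthonormal basis. The operator $T$ is of *Riesz trace class* if it is a Riesz operator with a West decomposition in which $T_C$ is of trace class, and then $\operatorname{tr}^R_{\mathcal H}(T)=\operatorname{tr}(T_C)$ for any such decomposition. **Theorem.** For every bounded finite potent operator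 $\varphi$ on a complex Hilbert space $\mathcal H$, $\mathcal H=W_\varphi\oplus U_\varphi$ is the unique AST-decomposition of $\mathcal H$ for $\varphi$; Tate's trace of $\varphi$ exists and is uniquely determined by (1)–(3); $\mathcal H/N(\varphi)$ is finite-dimensional; $\varphi$ is of Riesz trace class, and $\operatorname{tr}(T_C)$ is the same for all West decompositions $\varphi=T_C+T_Q$ with $T_C$ of trace class and for all orthonormal bases; and $$\operatorname{tr}_{\mathcal H}(\varphi)=\operatorname{tr}^R_{\mathcal H}(\varphi)=\operatorname{tr}^L_{\mathcal H}(\varphi)=\operatorname{tr}_{W_\varphi}\bigl(\varphi|_{W_\varphi}\bigr).$$ -/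

import Mathlib

open Polynomial

universe u v

namespace FinPotent

section Algebra

variable {k : Type v} [Field k] {V : Type u} [AddCommGroup V] [Module k V]

/-- `f` is finite potent: `f ^ n V` is finite-dimensional for some `n`. -/
def IsFinitePotent (f : Module.End k V) : Prop :=
  ∃ n : ℕ, FiniteDimensional k (LinearMap.range (f ^ n))

/-- The subspace of all `v` with `f ^ m v = 0` for some `m`, i.e. the union of the kernels of the
powers of `f`. It is the summand `U_f` of the AST-decomposition, and also the space `N(f)` in the
definition of the Leray trace. -/
def nilSubspace (f : Module.End k V) : Submodule k V where
  carrier := {v | ∃ m : ℕ, (f ^ m) v = 0}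
  zero_mem' := ⟨0, map_zero _⟩
  add_mem' := by
    rintro a b ⟨m, hm⟩ ⟨n, hn⟩
    refine ⟨m + n, ?_⟩
    have h1 : (f ^ (m + n)) a = 0 := by
      rw [add_comm, pow_add, Module.End.mul_apply, hm, map_zero]
    have h2 : (f ^ (m + n)) b = 0 := by
      rw [pow_add, Module.End.mul_apply, hn, map_zero]
    rw [map_add, h1, h2, add_zero]
  smul_mem' := by
    rintro c a ⟨m, hm⟩
    exact ⟨m, by rw [map_smul, hm, smul_zero]⟩

/-- The subspace `W_f` of all `v` with `p(f) v = 0` for some polynomial `p` relatively prime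
to `X`. -/
noncomputable def coreSubspace (f : Module.End k V) : Submodule k V where
  carrier := {v | ∃ p : k[X], IsCoprime p X ∧ (aeval f p) v = 0}
  zero_mem' := ⟨1, isCoprime_one_left, map_zero _⟩
  add_mem' := by
    rintro a b ⟨p, hp, hpa⟩ ⟨q, hq, hqb⟩
    refine ⟨p * q, hp.mul_left hq, ?_⟩
    have h1 : (aeval f (p * q)) a = 0 := by
      rw [mul_comm, map_mul, Module.End.mul_apply, hpa, map_zero]
    have h2 : (aeval f (p * q)) b = 0 := by
      rw [map_mul, Module.End.mul_apply, hqb, map_zero]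
    rw [map_add, h1, h2, add_zero]
  smul_mem' := by
    rintro c a ⟨p, hp, hpa⟩
    exact ⟨p, hp, by rw [map_smul, hpa, smul_zero]⟩

theorem nilSubspace_invariant (f : Module.End k V) : ∀ x ∈ nilSubspace f, f x ∈ nilSubspace f := by
  rintro x ⟨m, hm⟩
  refine ⟨m, ?_⟩
  rw [← Module.End.mul_apply, ← pow_succ, pow_succ', Module.End.mul_apply, hm, map_zero]

theorem coreSubspace_invariant (f : Module.End k V) :
    ∀ x ∈ coreSubspace f, f x ∈ coreSubspace f := by
  rintro x ⟨p, hp, hpx⟩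
  refine ⟨p, hp, ?_⟩
  have h : (aeval f p) * f = f * (aeval f p) := by
    have h0 := congrArg (aeval f) (mul_comm p X)
    simpa only [map_mul, aeval_X] using h0
  rw [← Module.End.mul_apply, h, Module.End.mul_apply, hpx, map_zero]

/-- `V = W ⊕ U` is an AST-decomposition of `V` for `f`: both summands are `f`-invariant, `f` is
nilpotent on `U`, `W` is finite-dimensional and `f` restricts to an automorphism of `W`. -/
structure IsASTDecomposition (f : Module.End k V) (W U : Submodule k V) : Prop where
  isCompl : IsCompl W U
  invariant_left : ∀ x ∈ W, f x ∈ W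
  invariant_right : ∀ x ∈ U, f x ∈ U
  nilpotent : IsNilpotent (LinearMap.restrict f invariant_right)
  finiteDimensional : FiniteDimensional k W
  bijective : Function.Bijective (LinearMap.restrict f invariant_left)

/-- The endomorphism of `V / N(f)` induced by `f`. -/
def lerayQuotientMap (f : Module.End k V) : Module.End k (V ⧸ nilSubspace f) :=
  (nilSubspace f).mapQ (nilSubspace f) f (nilSubspace_invariant f)

/-- The Leray trace of `f` exists (that is, `V / N(f)` is finite-dimensional) and equals `t`. -/
def HasLerayTrace (f : Module.End k V) (t : k) : Prop :=
  FiniteDimensional k (V ⧸ nilSubspace f) ∧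
    LinearMap.trace k (V ⧸ nilSubspace f) (lerayQuotientMap f) = t

end Algebra

/-- The three characteristic properties of Tate's trace, for a function `tr` on the endomorphisms
of all `k`-vector spaces; only its values at finite potent endomorphisms matter. -/
structure IsTateTrace {k : Type v} [Field k]
    (tr : ∀ (V : Type u) [AddCommGroup V] [Module k V], Module.End k V → k) : Prop where
  finiteDimensional : ∀ (V : Type u) [AddCommGroup V] [Module k V] [FiniteDimensional k V]
    (f : Module.End k V), tr V f = LinearMap.trace k V f
  additive : ∀ (V : Type u) [AddCommGroup V] [Module k V] (f : Module.End k V),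
    IsFinitePotent f → ∀ (W : Submodule k V) (hW : ∀ x ∈ W, f x ∈ W),
      tr V f = tr W (LinearMap.restrict f hW) + tr (V ⧸ W) (W.mapQ W f hW)
  nilpotent : ∀ (V : Type u) [AddCommGroup V] [Module k V] (f : Module.End k V),
    IsNilpotent f → tr V f = 0

/-- `f` is finite potent and Tate's trace of `f` is `t`: a trace with the three characteristic
properties exists, and every such trace takes the value `t` at `f`. -/
def HasTateTrace {k : Type v} [Field k] {V : Type u} [AddCommGroup V] [Module k V]
    (f : Module.End k V) (t : k) : Prop :=
  IsFinitePotent f ∧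
  (∃ tr : ∀ (V : Type u) [AddCommGroup V] [Module k V], Module.End k V → k, IsTateTrace tr) ∧
  ∀ tr : ∀ (V : Type u) [AddCommGroup V] [Module k V], Module.End k V → k,
    IsTateTrace tr → tr V f = t

section Banach

variable {E : Type u} [NormedAddCommGroup E] [NormedSpace ℂ E]

/-- `z ∈ σ(T)` is a Riesz point of `T`: `E = N ⊕ F` with `N`, `F` invariant under `T`, `N`
finite-dimensional, `F` closed, `T - z` nilpotent on `N` and a homeomorphism of `F` onto `F`. -/
def IsRieszPoint (T : E →L[ℂ] E) (z : ℂ) : Prop :=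
  z ∈ spectrum ℂ T ∧ ∃ N F : Submodule ℂ E, IsCompl N F ∧
    (∀ x ∈ N, T x ∈ N) ∧ (∀ x ∈ F, T x ∈ F) ∧
    FiniteDimensional ℂ N ∧ IsClosed (F : Set E) ∧
    (∃ m : ℕ, ∀ x ∈ N, ((T - z • ContinuousLinearMap.id ℂ E) ^ m) x = 0) ∧
    ∃ e : F ≃ₜ F, ∀ x : F, (e x : E) = T x - z • (x : E)

/-- Every non-zero point of the spectrum is a Riesz point. -/
def IsRieszOperator (T : E →L[ℂ] E) : Prop :=
  ∀ z ∈ spectrum ℂ T, z ≠ 0 → IsRieszPoint T z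

/-- Quasinilpotent: the spectrum is `{0}` (or empty, which happens only if `E = 0`). -/
def IsQuasinilpotent (T : E →L[ℂ] E) : Prop :=
  spectrum ℂ T ⊆ {0}

/-- `T = C + Q` is a West decomposition of the operator `T`. -/
structure IsWestDecomposition (T C Q : E →L[ℂ] E) : Prop where
  eq_add : T = C + Q
  compact : IsCompactOperator C
  quasinilpotent : IsQuasinilpotent Q
  comp_left : C ∘L Q = 0
  comp_right : Q ∘L C = 0

end Banach

section Hilbert

variable {H : Type u} [NormedAddCommGroup H] [InnerProductSpace ℂ H] [CompleteSpace H]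

/-- `C` is a trace class operator: it is compact and `∑ ⟨|C| b_i, b_i⟩ < ∞`, where
`|C| = (C* C)^(1/2)`, in every orthonormal basis; that is, the sum of the eigenvalues of `|C|`
(the singular values of `C`), counted with multiplicity, is finite. -/
def IsTraceClass (C : H →L[ℂ] H) : Prop :=
  IsCompactOperator C ∧
    ∀ (ι : Type u) (b : HilbertBasis ι ℂ H), Summable fun i => inner ℂ (b i) (CFC.abs C (b i))

/-- The trace of `C` is `t`: in every orthonormal basis the sum of the diagonal entries of `C`
converges unconditionally to `t`. -/
def HasTrace (C : H →L[ℂ] H) (t : ℂ) : Prop :=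
  ∀ (ι : Type u) (b : HilbertBasis ι ℂ H), HasSum (fun i => inner ℂ (b i) (C (b i))) t

/-- `T` is a Riesz operator with a West decomposition `T = C + Q` such that `C` is of trace
class. -/
def IsRieszTraceClass (T : H →L[ℂ] H) : Prop :=
  IsRieszOperator T ∧ ∃ C Q : H →L[ℂ] H, IsWestDecomposition T C Q ∧ IsTraceClass C

/-- `T` is of Riesz trace class and its Riesz trace is `t`: for every West decomposition
`T = C + Q` with `C` of trace class, the trace of `C` is `t`. -/
def HasRieszTrace (T : H →L[ℂ] H) (t : ℂ) : Prop :=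
  IsRieszTraceClass T ∧
    ∀ C Q : H →L[ℂ] H, IsWestDecomposition T C Q → IsTraceClass C → HasTrace C t

end Hilbert

end FinPotent

/-!
A finite potent `φ` is annihilated by a polynomial `X ^ n * q` with `q` coprime to `X`: multiply
`X ^ n` by the characteristic polynomial of `φ` on the finite-dimensional space `φ ^ n H`
(`IsFinitePotent.exists_aeval_eq_zero`). Hence `U_φ = ker φ ^ n`, `W_φ = ker q(φ)`, and these two
are complementary. The common value of all traces is `coreTrace φ`, the trace of `φ` on `W_φ`.

* Tate's trace: for an invariant subspace `W` the cores of `f|W`, `f` and `f mod W` form a short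
  exact sequence, so `coreTrace` has the three characteristic properties. Any other trace with
  these properties agrees with it, because it vanishes on `N(f)` and is the ordinary trace on the
  finite-dimensional quotient by `N(f)`.
* Riesz trace class: `φ` satisfies a polynomial equation, so the kernels of complementary factors of
  the polynomial give the Riesz decompositions, and a Bézout identity gives a projection onto `W_φ`
  that is a polynomial in `φ`, hence bounded. It splits `φ` into a finite rank part and a
  nilpotent part.
* Riesz trace: in any West decomposition `φ = C + Q` one has `C ^ (n + 1) = C φ ^ n`, so `C` and,
  symmetrically, `Q` are finite potent. As `Q` is also quasinilpotent it is nilpotent, and so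
  `coreTrace φ = coreTrace C`. This reduces the claim to a finite potent trace class operator `C`,
  and Lidskii's theorem is not needed. Expanding in an eigenbasis of `C* C` shows that the diagonal
  sums of `C` converge absolutely to the same value in all orthonormal bases
  (`IsTraceClass.exists_hasTrace`). In a basis adapted to the flag `ker C ≤ ker C ^ 2 ≤ ⋯ ≤ H` the
  matrix of `C` is strictly upper triangular except for the finite block of `N(C)ᗮ`, whose trace is
  the Leray trace (`exists_hilbertBasis_hasSum_coreTrace`).
-/

namespace FinPotent

/-! ### AST-decompositions -/

section Algebra

variable {k : Type v} [Field k] {V : Type u} [AddCommGroup V] [Module k V]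

theorem mem_coreSubspace {f : Module.End k V} {x : V} :
    x ∈ coreSubspace f ↔ ∃ p : k[X], IsCoprime p X ∧ (aeval f p) x = 0 := Iff.rfl

theorem eq_zero_of_aeval_eq_zero_of_isCoprime {f : Module.End k V} {p q : k[X]}
    (h : IsCoprime p q) {x : V} (hp : aeval f p x = 0) (hq : aeval f q x = 0) : x = 0 := by
  obtain ⟨a, b, hab⟩ := h
  have := congrArg (fun r => aeval f r x) hab
  simpa [Module.End.mul_apply, hp, hq] using this.symm

theorem aeval_restrict_apply {f : Module.End k V} {W : Submodule k V} (hW : ∀ x ∈ W, f x ∈ W)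
    (p : k[X]) (x : W) : ((aeval (f.restrict hW) p x : W) : V) = aeval f p x := by
  have h : W.subtype ∘ₗ f.restrict hW = f ∘ₗ W.subtype := rfl
  induction p using Polynomial.induction_on' with
  | add p q hp hq => simp [hp, hq]
  | monomial n a =>
    simp only [aeval_monomial, Module.algebraMap_end_eq_smul_id, Module.End.mul_apply,
      LinearMap.smul_apply, LinearMap.id_apply, Submodule.coe_smul]
    congr 1
    induction n generalizing x with
    | zero => simp
    | succ n ih => rw [pow_succ, pow_succ, Module.End.mul_apply, Module.End.mul_apply, ih]; rfl

theorem aeval_mapQ_mk {f : Module.End k V} {W : Submodule k V} (hW : ∀ x ∈ W, f x ∈ W)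
    (p : k[X]) (x : V) :
    aeval (W.mapQ W f hW : Module.End k (V ⧸ W)) p (W.mkQ x) = W.mkQ (aeval f p x) := by
  induction p using Polynomial.induction_on' with
  | add p q hp hq => simp only [map_add, LinearMap.add_apply, hp, hq]
  | monomial n a =>
    simp only [aeval_monomial, Module.algebraMap_end_eq_smul_id, Module.End.mul_apply,
      LinearMap.smul_apply, LinearMap.id_apply, map_smul]
    congr 1
    induction n generalizing x with
    | zero => simp
    | succ n ih => rw [pow_succ, pow_succ, Module.End.mul_apply, Module.End.mul_apply, ← ih]; rfl

theorem exists_eq_X_pow_mul_isCoprime {p : k[X]} (hp : p ≠ 0) :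
    ∃ (n : ℕ) (q : k[X]), p = X ^ n * q ∧ IsCoprime q X := by
  obtain ⟨q, hq, hd⟩ := p.exists_eq_pow_rootMultiplicity_mul_and_not_dvd hp 0
  rw [C_0, sub_zero] at hq hd
  exact ⟨_, q, hq, ((irreducible_X.coprime_iff_not_dvd).2 hd).symm⟩

/-- A finite potent endomorphism is algebraic: multiply `X ^ n` by the characteristic polynomial
of `f` on the finite-dimensional space `f ^ n V`. -/
theorem IsFinitePotent.exists_aeval_eq_zero {f : Module.End k V} (hf : IsFinitePotent f) :
    ∃ (n : ℕ) (q : k[X]), IsCoprime q X ∧ aeval f (X ^ n * q) = 0 := by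
  obtain ⟨n, hn⟩ := hf
  have hR : ∀ x ∈ LinearMap.range (f ^ n), f x ∈ LinearMap.range (f ^ n) := by
    rintro _ ⟨y, rfl⟩
    exact ⟨f y, by rw [← Module.End.mul_apply, ← Module.End.mul_apply, ← pow_succ, pow_succ']⟩
  set g := f.restrict hR
  have hχ : aeval f (g.charpoly * X ^ n) = 0 := by
    ext x
    have := aeval_restrict_apply hR g.charpoly ⟨(f ^ n) x, x, rfl⟩
    rw [show f.restrict hR = g from rfl, LinearMap.aeval_self_charpoly] at this
    simpa [Module.End.mul_apply] using this.symm
  have h0 : g.charpoly * X ^ n ≠ 0 :=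
    mul_ne_zero g.charpoly_monic.ne_zero (pow_ne_zero _ X_ne_zero)
  obtain ⟨N, q, hN, hq⟩ := exists_eq_X_pow_mul_isCoprime h0
  exact ⟨N, q, hq, hN ▸ hχ⟩

section Annihilator

variable {f : Module.End k V} {n : ℕ} {q : k[X]}

theorem nilSubspace_eq_ker_pow (hq : IsCoprime q X) (h : aeval f (X ^ n * q) = 0) :
    nilSubspace f = LinearMap.ker (f ^ n) := by
  refine le_antisymm ?_ fun x hx => ⟨n, hx⟩
  rintro x ⟨m, hm⟩
  rw [LinearMap.mem_ker]
  refine eq_zero_of_aeval_eq_zero_of_isCoprime (f := f) (hq.pow_right (n := m)) ?_ ?_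
  · have := LinearMap.congr_fun h x
    rw [mul_comm] at this
    simpa [Module.End.mul_apply] using this
  · rw [map_pow, aeval_X, ← Module.End.mul_apply, ← pow_add, add_comm, pow_add,
      Module.End.mul_apply, hm, map_zero]

theorem coreSubspace_eq_ker_aeval (hq : IsCoprime q X) (h : aeval f (X ^ n * q) = 0) :
    coreSubspace f = LinearMap.ker (aeval f q) := by
  refine le_antisymm ?_ fun x hx => ⟨q, hq, hx⟩
  rintro x ⟨p, hp, hpx⟩
  rw [LinearMap.mem_ker]
  refine eq_zero_of_aeval_eq_zero_of_isCoprime (f := f) (hp.pow_right (n := n)) ?_ ?_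
  · rw [← Module.End.mul_apply, ← map_mul, mul_comm, map_mul, Module.End.mul_apply, hpx, map_zero]
  · rw [← Module.End.mul_apply, ← map_mul, h, LinearMap.zero_apply]

end Annihilator

theorem coreSubspace_disjoint_nilSubspace (f : Module.End k V) :
    Disjoint (coreSubspace f) (nilSubspace f) := by
  rw [Submodule.disjoint_def]
  rintro x ⟨p, hp, hpx⟩ ⟨m, hm⟩
  exact eq_zero_of_aeval_eq_zero_of_isCoprime (f := f) (hp.pow_right (n := m)) hpx (by simpa)

/-- On the core `f` is invertible: a Bézout identity `a p + b X ^ n = 1` exhibits `x = f ^ n b(f) x`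
whenever `p(f) x = 0`. -/
theorem coreSubspace_le_range_pow (f : Module.End k V) (n : ℕ) :
    coreSubspace f ≤ LinearMap.range (f ^ n) := by
  rintro x ⟨p, hp, hpx⟩
  obtain ⟨a, b, hab⟩ := hp.pow_right (n := n)
  refine ⟨aeval f b x, ?_⟩
  have := congrArg (fun r => aeval f r x) hab
  rw [mul_comm b] at this
  simpa [Module.End.mul_apply, hpx] using this

theorem IsFinitePotent.isCompl {f : Module.End k V} (hf : IsFinitePotent f) :
    IsCompl (coreSubspace f) (nilSubspace f) := by
  obtain ⟨n, q, hq, h⟩ := hf.exists_aeval_eq_zero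
  refine ⟨coreSubspace_disjoint_nilSubspace f, codisjoint_iff.2 ?_⟩
  have := sup_ker_aeval_eq_ker_aeval_mul_of_coprime f (hq.symm.pow_left (m := n))
  rw [h, LinearMap.ker_zero, map_pow, aeval_X, sup_comm, ← nilSubspace_eq_ker_pow hq h,
    ← coreSubspace_eq_ker_aeval hq h] at this
  exact this

theorem IsFinitePotent.finiteDimensional_coreSubspace {f : Module.End k V}
    (hf : IsFinitePotent f) : FiniteDimensional k (coreSubspace f) := by
  obtain ⟨n, hn⟩ := hf
  exact Submodule.finiteDimensional_of_le (coreSubspace_le_range_pow f n)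

theorem IsFinitePotent.isNilpotent_restrict {f : Module.End k V} (hf : IsFinitePotent f) :
    IsNilpotent (f.restrict (nilSubspace_invariant f)) := by
  obtain ⟨n, q, hq, h⟩ := hf.exists_aeval_eq_zero
  refine ⟨n, ?_⟩
  ext x
  have h1 := aeval_restrict_apply (nilSubspace_invariant f) (X ^ n) x
  have h2 : (x : V) ∈ LinearMap.ker (f ^ n) := nilSubspace_eq_ker_pow hq h ▸ x.2
  simp only [map_pow, aeval_X] at h1
  rw [h1]
  simpa using h2

theorem injective_restrict_coreSubspace (f : Module.End k V) :
    Function.Injective (f.restrict (coreSubspace_invariant f)) := by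
  rw [← LinearMap.ker_eq_bot, LinearMap.ker_eq_bot']
  intro x hx
  have h1 : f x = 0 := congrArg Subtype.val hx
  exact Subtype.ext ((Submodule.disjoint_def.1 (coreSubspace_disjoint_nilSubspace f)) x x.2
    ⟨1, by simpa using h1⟩)

theorem IsFinitePotent.isASTDecomposition {f : Module.End k V} (hf : IsFinitePotent f) :
    IsASTDecomposition f (coreSubspace f) (nilSubspace f) :=
  have := hf.finiteDimensional_coreSubspace
  { isCompl := hf.isCompl
    invariant_left := coreSubspace_invariant f
    invariant_right := nilSubspace_invariant f
    nilpotent := hf.isNilpotent_restrict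
    finiteDimensional := this
    bijective := ⟨injective_restrict_coreSubspace f,
      LinearMap.injective_iff_surjective.1 (injective_restrict_coreSubspace f)⟩ }

theorem IsASTDecomposition.right_le {f : Module.End k V} {W U : Submodule k V}
    (h : IsASTDecomposition f W U) : U ≤ nilSubspace f := by
  obtain ⟨n, hn⟩ := h.nilpotent
  intro x hx
  refine ⟨n, ?_⟩
  have h1 := aeval_restrict_apply h.invariant_right (X ^ n) ⟨x, hx⟩
  simp only [map_pow, aeval_X] at h1
  rw [← h1, hn]; rfl

/-- The characteristic polynomial of an automorphism of `W` is coprime to `X`, and annihilates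
`W` by Cayley–Hamilton. -/
theorem IsASTDecomposition.left_le {f : Module.End k V} {W U : Submodule k V}
    (h : IsASTDecomposition f W U) : W ≤ coreSubspace f := by
  have := h.finiteDimensional
  intro x hx
  set g := f.restrict h.invariant_left
  refine ⟨g.charpoly, ?_, ?_⟩
  · refine ((irreducible_X.coprime_iff_not_dvd).2 fun hd => ?_).symm
    rw [X_dvd_iff] at hd
    have h0 : IsUnit (LinearMap.det g) :=
      LinearEquiv.isUnit_det' (LinearEquiv.ofBijective g h.bijective)
    rw [LinearMap.det_eq_sign_charpoly_coeff, hd, mul_zero] at h0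
    exact not_isUnit_zero h0
  · rw [← aeval_restrict_apply h.invariant_left _ ⟨x, hx⟩]
    simp [show f.restrict h.invariant_left = g from rfl, LinearMap.aeval_self_charpoly]

theorem IsASTDecomposition.left_eq {f : Module.End k V} {W U : Submodule k V}
    (h : IsASTDecomposition f W U) : W = coreSubspace f :=
  eq_of_le_of_inf_le_of_sup_le (z := U) h.left_le
    (((coreSubspace_disjoint_nilSubspace f).mono_right h.right_le).le_bot.trans bot_le)
    (le_top.trans h.isCompl.codisjoint.top_le)

theorem IsASTDecomposition.right_eq {f : Module.End k V} {W U : Submodule k V}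
    (h : IsASTDecomposition f W U) : U = nilSubspace f :=
  eq_of_le_of_inf_le_of_sup_le (z := W) h.right_le
    (((coreSubspace_disjoint_nilSubspace f).symm.mono_right h.left_le).le_bot.trans bot_le)
    (le_top.trans h.isCompl.symm.codisjoint.top_le)

end Algebra

/-! ### Tate's trace and the Leray trace -/

section Trace

variable {k : Type v} [Field k]

/-- Additivity of the trace in a short exact sequence `0 → A → B → C → 0`. With a retraction `r`
of `i` and a section `s` of `p` one has `1 = i r + s p`, and the trace is cyclic. -/
theorem trace_eq_add_of_exact {A B C : Type*} [AddCommGroup A] [Module k A] [AddCommGroup B]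
    [Module k B] [AddCommGroup C] [Module k C] [FiniteDimensional k A] [FiniteDimensional k B]
    [FiniteDimensional k C] {i : A →ₗ[k] B} {p : B →ₗ[k] C} (hi : Function.Injective i)
    (hp : Function.Surjective p) (hip : Function.Exact i p) {fA : Module.End k A}
    {fB : Module.End k B} {fC : Module.End k C} (hA : fB ∘ₗ i = i ∘ₗ fA)
    (hC : p ∘ₗ fB = fC ∘ₗ p) :
    LinearMap.trace k B fB = LinearMap.trace k A fA + LinearMap.trace k C fC := by
  obtain ⟨s, hs⟩ := p.exists_rightInverse_of_surjective (LinearMap.range_eq_top.2 hp)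
  obtain ⟨r₀, hr₀⟩ := i.exists_leftInverse_of_injective (LinearMap.ker_eq_bot.2 hi)
  -- A left inverse of `i`, corrected to vanish on the range of `s`.
  obtain ⟨r, hr⟩ : ∃ r, r = r₀ ∘ₗ (LinearMap.id - s ∘ₗ p) := ⟨_, rfl⟩
  have hpi : p ∘ₗ i = 0 := hip.linearMap_comp_eq_zero
  have hri : r ∘ₗ i = LinearMap.id := by
    rw [hr, LinearMap.comp_assoc, LinearMap.sub_comp, LinearMap.comp_assoc, hpi]
    simpa using hr₀
  have hid : i ∘ₗ r + s ∘ₗ p = LinearMap.id := by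
    ext x
    have hx : p (x - s (p x)) = 0 := by
      have := LinearMap.congr_fun hs (p x)
      simp only [LinearMap.comp_apply, LinearMap.id_apply] at this
      rw [map_sub, this, sub_self]
    obtain ⟨a, ha⟩ := (hip _).1 hx
    have h1 : r₀ (i a) = a := LinearMap.congr_fun hr₀ a
    simp only [hr, LinearMap.add_apply, LinearMap.comp_apply, LinearMap.sub_apply,
      LinearMap.id_apply]
    rw [← ha, h1, ha, sub_add_cancel]
  have h1 : LinearMap.trace k B (fB ∘ₗ (i ∘ₗ r)) = LinearMap.trace k A fA := by
    rw [← LinearMap.comp_assoc, hA, LinearMap.trace_comp_comm', ← LinearMap.comp_assoc, hri,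
      LinearMap.id_comp]
  have h2 : LinearMap.trace k B (fB ∘ₗ (s ∘ₗ p)) = LinearMap.trace k C fC := by
    rw [← LinearMap.comp_assoc, LinearMap.trace_comp_comm', ← LinearMap.comp_assoc, hC,
      LinearMap.comp_assoc, hs, LinearMap.comp_id]
  rw [← h1, ← h2, ← map_add, ← LinearMap.comp_add, hid, LinearMap.comp_id]

theorem trace_eq_zero_of_isNilpotent {V : Type*} [AddCommGroup V] [Module k V]
    {f : Module.End k V} (hf : IsNilpotent f) : LinearMap.trace k V f = 0 :=
  (LinearMap.isNilpotent_trace_of_isNilpotent hf).eq_zero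

/-- The trace of `f` on the summand `W_f`. For finite potent `f` this is Tate's trace. -/
noncomputable def coreTrace {V : Type u} [AddCommGroup V] [Module k V] (f : Module.End k V) : k :=
  LinearMap.trace k (coreSubspace f) (f.restrict (coreSubspace_invariant f))

variable {V : Type u} [AddCommGroup V] [Module k V]

theorem IsFinitePotent.hasLerayTrace {f : Module.End k V} (hf : IsFinitePotent f) :
    HasLerayTrace f (coreTrace f) := by
  have := hf.finiteDimensional_coreSubspace
  let e := (nilSubspace f).quotientEquivOfIsCompl (coreSubspace f) hf.isCompl.symm
  refine ⟨e.symm.finiteDimensional, ?_⟩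
  have h : e.symm.conj (f.restrict (coreSubspace_invariant f)) = lerayQuotientMap f := by
    apply LinearMap.ext
    intro y
    obtain ⟨x, rfl⟩ := e.symm.surjective y
    rw [LinearEquiv.conj_apply_apply, LinearEquiv.symm_symm, LinearEquiv.apply_symm_apply]
    simp only [e, Submodule.quotientEquivOfIsCompl_symm_apply]
    rfl
  rw [← h, LinearMap.trace_conj']
  rfl

theorem mem_coreSubspace_restrict {f : Module.End k V} {W : Submodule k V}
    (hW : ∀ x ∈ W, f x ∈ W) (x : W) :
    x ∈ coreSubspace (f.restrict hW) ↔ (x : V) ∈ coreSubspace f := by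
  simp only [mem_coreSubspace, ← aeval_restrict_apply hW, ZeroMemClass.coe_eq_zero]

theorem mkQ_mem_coreSubspace {f : Module.End k V} {W : Submodule k V}
    (hW : ∀ x ∈ W, f x ∈ W) {x : V} (hx : x ∈ coreSubspace f) :
    W.mkQ x ∈ coreSubspace (W.mapQ W f hW) := by
  obtain ⟨p, hp, hpx⟩ := hx
  exact ⟨p, hp, by rw [aeval_mapQ_mk, hpx, map_zero]⟩

/-- The core of the induced endomorphism of `V ⧸ W` is the image of the core of `f`. -/
theorem IsFinitePotent.exists_mkQ_eq {f : Module.End k V} (hf : IsFinitePotent f)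
    {W : Submodule k V} (hW : ∀ x ∈ W, f x ∈ W) {y : V ⧸ W}
    (hy : y ∈ coreSubspace (W.mapQ W f hW)) : ∃ x ∈ coreSubspace f, W.mkQ x = y := by
  obtain ⟨v, rfl⟩ := W.mkQ_surjective y
  -- The class of the component `u` in `U_f` is both nilpotent and in the core, hence zero.
  obtain ⟨w, hw, u, ⟨m, hm⟩, rfl⟩ :=
    Submodule.mem_sup.1 (hf.isCompl.codisjoint.top_le (Submodule.mem_top (x := v)))
  refine ⟨w, hw, ?_⟩
  have h1 : W.mkQ u ∈ coreSubspace (W.mapQ W f hW) := by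
    have := sub_mem hy (mkQ_mem_coreSubspace hW hw)
    rwa [← map_sub, add_sub_cancel_left] at this
  have h2 : W.mkQ u ∈ nilSubspace (W.mapQ W f hW) := by
    refine ⟨m, ?_⟩
    have := aeval_mapQ_mk hW (X ^ m) u
    simp only [map_pow, aeval_X] at this
    rw [this, hm, map_zero]
  rw [map_add, Submodule.disjoint_def.1 (coreSubspace_disjoint_nilSubspace _) _ h1 h2, add_zero]

theorem IsFinitePotent.restrict {f : Module.End k V} (hf : IsFinitePotent f)
    {W : Submodule k V} (hW : ∀ x ∈ W, f x ∈ W) : IsFinitePotent (f.restrict hW) := by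
  obtain ⟨n, hn⟩ := hf
  refine ⟨n, ?_⟩
  have h : ∀ x : LinearMap.range (f.restrict hW ^ n),
      W.subtype.domRestrict _ x ∈ LinearMap.range (f ^ n) := by
    rintro ⟨_, y, rfl⟩
    refine ⟨y, ?_⟩
    have := aeval_restrict_apply hW (X ^ n) y
    simp only [map_pow, aeval_X] at this
    exact this.symm
  refine FiniteDimensional.of_injective ((W.subtype.domRestrict _).codRestrict _ h) ?_
  intro x y hxy
  exact Subtype.ext (Subtype.ext (congrArg (fun z : LinearMap.range (f ^ n) => (z : V)) hxy))

theorem IsFinitePotent.mapQ {f : Module.End k V} (hf : IsFinitePotent f)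
    {W : Submodule k V} (hW : ∀ x ∈ W, f x ∈ W) : IsFinitePotent (W.mapQ W f hW) := by
  obtain ⟨n, hn⟩ := hf
  refine ⟨n, Submodule.finiteDimensional_of_le (S₂ := (LinearMap.range (f ^ n)).map W.mkQ) ?_⟩
  rintro _ ⟨y, rfl⟩
  obtain ⟨x, rfl⟩ := W.mkQ_surjective y
  have := aeval_mapQ_mk hW (X ^ n) x
  simp only [map_pow, aeval_X] at this
  exact ⟨_, ⟨x, rfl⟩, this.symm⟩

/-- The sequence `0 → W_{f|W} → W_f → W_{f mod W} → 0` is exact. -/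
theorem IsFinitePotent.coreTrace_eq_add {f : Module.End k V} (hf : IsFinitePotent f)
    {W : Submodule k V} (hW : ∀ x ∈ W, f x ∈ W) :
    coreTrace f = coreTrace (f.restrict hW) + coreTrace (W.mapQ W f hW : Module.End k (V ⧸ W)) := by
  have := hf.finiteDimensional_coreSubspace
  have := (hf.restrict hW).finiteDimensional_coreSubspace
  have := (hf.mapQ hW).finiteDimensional_coreSubspace
  let i : coreSubspace (f.restrict hW) →ₗ[k] coreSubspace f :=
    W.subtype.restrict fun x hx => (mem_coreSubspace_restrict hW x).1 hx
  let p : coreSubspace f →ₗ[k] coreSubspace (W.mapQ W f hW : Module.End k (V ⧸ W)) :=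
    W.mkQ.restrict fun x hx => mkQ_mem_coreSubspace hW hx
  refine trace_eq_add_of_exact (i := i) (p := p) ?_ ?_ ?_ rfl rfl
  · intro x y hxy
    exact Subtype.ext (Subtype.ext (congrArg (fun z : coreSubspace f => (z : V)) hxy))
  · rintro ⟨y, hy⟩
    obtain ⟨x, hx, rfl⟩ := hf.exists_mkQ_eq hW hy
    exact ⟨⟨x, hx⟩, rfl⟩
  · rintro ⟨x, hx⟩
    constructor
    · intro h
      have hxW : x ∈ W := (Submodule.Quotient.mk_eq_zero W).1 (congrArg Subtype.val h)
      exact ⟨⟨⟨x, hxW⟩, (mem_coreSubspace_restrict hW _).2 hx⟩, rfl⟩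
    · rintro ⟨y, hy⟩
      rw [← hy]
      exact Subtype.ext ((Submodule.Quotient.mk_eq_zero W).2 y.1.2)

theorem isFinitePotent_of_finiteDimensional [FiniteDimensional k V] (f : Module.End k V) :
    IsFinitePotent f :=
  ⟨0, inferInstance⟩

theorem coreTrace_eq_trace [FiniteDimensional k V] (f : Module.End k V) :
    coreTrace f = LinearMap.trace k V f := by
  have hf := isFinitePotent_of_finiteDimensional f
  rw [trace_eq_add_of_exact (i := (nilSubspace f).subtype) (p := (nilSubspace f).mkQ)
    (fA := f.restrict (nilSubspace_invariant f)) (fC := lerayQuotientMap f)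
    (Submodule.injective_subtype _) (Submodule.mkQ_surjective _)
    (LinearMap.exact_subtype_mkQ _) rfl rfl, trace_eq_zero_of_isNilpotent hf.isNilpotent_restrict,
    zero_add]
  exact hf.hasLerayTrace.2.symm

theorem coreTrace_eq_zero_of_isNilpotent {f : Module.End k V} (hf : IsNilpotent f) :
    coreTrace f = 0 := by
  obtain ⟨n, hn⟩ := hf
  refine trace_eq_zero_of_isNilpotent ⟨n, ?_⟩
  ext x
  have := aeval_restrict_apply (coreSubspace_invariant f) (X ^ n) x
  simp only [map_pow, aeval_X] at this
  rw [this, hn]; rfl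

theorem isTateTrace_coreTrace : IsTateTrace.{u, v} (k := k) fun _ _ _ f => coreTrace f where
  finiteDimensional _ _ _ _ f := coreTrace_eq_trace f
  additive _ _ _ _ hf _ hW := hf.coreTrace_eq_add hW
  nilpotent _ _ _ _ hf := coreTrace_eq_zero_of_isNilpotent hf

/-- Existence is `isTateTrace_coreTrace`; a trace with the three properties is determined by its
value on the finite-dimensional quotient by `N(f)`, as it vanishes on `N(f)`. -/
theorem IsFinitePotent.hasTateTrace {f : Module.End k V} (hf : IsFinitePotent f) :
    HasTateTrace f (coreTrace f) := by
  refine ⟨hf, ⟨_, isTateTrace_coreTrace⟩, fun tr htr => ?_⟩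
  obtain ⟨hfin, hL⟩ := hf.hasLerayTrace
  rw [htr.additive V f hf _ (nilSubspace_invariant f), htr.nilpotent _ _ hf.isNilpotent_restrict,
    zero_add, htr.finiteDimensional]
  exact hL

/-! ### Restriction to the core and annihilating summands -/

theorem mul_add_pow_of_mul_eq_zero {R : Type*} [Semiring R] {a b : R} (h : a * b = 0) (n : ℕ) :
    a * (a + b) ^ n = a ^ (n + 1) := by
  induction n with
  | zero => simp
  | succ n ih =>
    rw [pow_succ, ← mul_assoc, ih, mul_add, pow_succ a n, mul_assoc _ a b, h, mul_zero, add_zero,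
      ← pow_succ, ← pow_succ]

theorem coreSubspace_le_of_eqOn {f g : Module.End k V} (h : ∀ x ∈ coreSubspace f, f x = g x) :
    coreSubspace f ≤ coreSubspace g := by
  have hg : ∀ x ∈ coreSubspace f, g x ∈ coreSubspace f := fun x hx =>
    h x hx ▸ coreSubspace_invariant f x hx
  have hfg : g.restrict hg = f.restrict (coreSubspace_invariant f) :=
    LinearMap.ext fun x => Subtype.ext (h x x.2).symm
  intro x hx
  obtain ⟨p, hp, hpx⟩ := id hx
  refine ⟨p, hp, ?_⟩
  rw [← aeval_restrict_apply hg p ⟨x, hx⟩, hfg, aeval_restrict_apply]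
  exact hpx

theorem trace_restrict_congr {f g : Module.End k V} {W W' : Submodule k V} (hW : W = W')
    (hf : ∀ x ∈ W, f x ∈ W) (hg : ∀ x ∈ W', g x ∈ W') (h : ∀ x ∈ W, f x = g x) :
    LinearMap.trace k W (f.restrict hf) = LinearMap.trace k W' (g.restrict hg) := by
  subst hW
  congr 1
  exact LinearMap.ext fun x => Subtype.ext (h x x.2)

/-- `f ^ (n + 1) = f (f + g) ^ n` has finite rank for large `n`. -/
theorem IsFinitePotent.of_add {f g : Module.End k V} (h : f * g = 0)
    (hfg : IsFinitePotent (f + g)) : IsFinitePotent f := by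
  obtain ⟨n, hn⟩ := hfg
  refine ⟨n + 1, ?_⟩
  rw [← mul_add_pow_of_mul_eq_zero h n, Module.End.mul_eq_comp, LinearMap.range_comp]
  infer_instance

/-- `f + g` and `f` agree on both cores: these lie in the ranges of `(f + g) ^ n` and of `f`, and
`g` kills both ranges since `g (f + g) ^ n = g ^ (n + 1) = 0` and `g f = 0`. -/
theorem coreTrace_add_eq {f g : Module.End k V} (hgf : g * f = 0)
    (hg : IsNilpotent g) : coreTrace (f + g) = coreTrace f := by
  obtain ⟨n, hn⟩ := hg
  have h1 : ∀ x ∈ coreSubspace (f + g), (f + g) x = f x := by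
    intro x hx
    obtain ⟨y, rfl⟩ := coreSubspace_le_range_pow _ n hx
    rw [LinearMap.add_apply, ← Module.End.mul_apply g, add_comm f g,
      mul_add_pow_of_mul_eq_zero hgf, pow_succ, hn, zero_mul, LinearMap.zero_apply, add_zero]
  have h2 : ∀ x ∈ coreSubspace f, f x = (f + g) x := by
    intro x hx
    obtain ⟨y, rfl⟩ := coreSubspace_le_range_pow _ 1 hx
    rw [LinearMap.add_apply, pow_one, ← Module.End.mul_apply g, hgf, LinearMap.zero_apply,
      add_zero]
  exact trace_restrict_congr (le_antisymm (coreSubspace_le_of_eqOn h1) (coreSubspace_le_of_eqOn h2))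
    _ _ h1

end Trace

/-! ### Diagonal sums in orthonormal bases -/

section HilbertBasis

variable {H : Type u} [NormedAddCommGroup H] [InnerProductSpace ℂ H] [CompleteSpace H]

/-- Hilbert bases of the members of a total orthogonal family of complete subspaces combine to a
Hilbert basis of the whole space. -/
theorem exists_hilbertBasis_sigma {ι : Type*} (F : ι → Submodule ℂ H) [∀ i, CompleteSpace (F i)]
    (hF : OrthogonalFamily ℂ (fun i => F i) fun i => (F i).subtypeₗᵢ) (ht : (⨆ i, F i)ᗮ = ⊥) :
    ∃ (κ : ι → Type u) (c : ∀ i, HilbertBasis (κ i) ℂ (F i))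
      (b : HilbertBasis (Σ i, κ i) ℂ H), ∀ a, b a = (c a.1 a.2 : H) := by
  choose w c hc using fun i => exists_hilbertBasis ℂ (F i)
  have hv := hF.orthonormal_sigma_orthonormal fun i => (c i).orthonormal
  refine ⟨fun i => w i, c, HilbertBasis.mkOfOrthogonalEqBot hv ?_, fun a => ?_⟩
  · rw [eq_bot_iff, ← ht, ← Submodule.iInf_orthogonal]
    intro x hx
    rw [Submodule.mem_iInf]
    intro i
    rw [← Submodule.orthogonalProjectionOnto_eq_zero_iff]
    apply (c i).repr.injective
    ext j
    rw [map_zero, (c i).repr_apply_apply, Submodule.inner_orthogonalProjectionOnto_eq_of_mem_left]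
    exact hx _ (Submodule.subset_span ⟨⟨i, j⟩, rfl⟩)
  · rw [HilbertBasis.coe_mkOfOrthogonalEqBot]
    rfl

/-- If `∑ ‖C e_j‖ < ∞` for one orthonormal basis `e`, then `C` has a trace: Bessel's inequality
makes `∑ ⟨e_j, b_i⟩ ⟨b_i, C e_j⟩` absolutely convergent as a double series for any second
orthonormal basis `b`, and its two iterated sums are the diagonal sums in `e` and in `b`. -/
theorem exists_hasTrace_of_summable_norm {C : H →L[ℂ] H} {κ : Type*} (e : HilbertBasis κ ℂ H)
    (hs : Summable fun j => ‖C (e j)‖) : ∃ t, HasTrace C t := by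
  refine ⟨∑' j, inner ℂ (e j) (C (e j)), fun ι b => ?_⟩
  let F : κ × ι → ℂ := fun a => inner ℂ (e a.1) (b a.2) * inner ℂ (b a.2) (C (e a.1))
  have hrow (j : κ) : HasSum (fun i => F (j, i)) (inner ℂ (e j) (C (e j))) :=
    b.hasSum_inner_mul_inner (e j) (C (e j))
  have hcol (i : ι) : HasSum (fun j => F (j, i)) (inner ℂ (b i) (C (b i))) := by
    have := e.hasSum_inner_mul_inner (ContinuousLinearMap.adjoint C (b i)) (b i)
    simp only [ContinuousLinearMap.adjoint_inner_left] at this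
    simpa only [F, mul_comm] using this
  have hbound (j : κ) : ∑' i, ‖F (j, i)‖ ≤ ‖C (e j)‖ := by
    refine (hrow j).summable.norm.tsum_le_of_sum_le fun s => ?_
    calc ∑ i ∈ s, ‖F (j, i)‖
        = ∑ i ∈ s, ‖inner ℂ (b i) (e j)‖ * ‖inner ℂ (b i) (C (e j))‖ := by
          simp only [F, norm_mul, norm_inner_symm (e j)]
      _ ≤ √(∑ i ∈ s, ‖inner ℂ (b i) (e j)‖ ^ 2) * √(∑ i ∈ s, ‖inner ℂ (b i) (C (e j))‖ ^ 2) :=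
          Real.sum_mul_le_sqrt_mul_sqrt _ _ _
      _ ≤ √(‖e j‖ ^ 2) * √(‖C (e j)‖ ^ 2) := by
          gcongr <;> exact b.orthonormal.sum_inner_products_le _
      _ = ‖C (e j)‖ := by
          rw [e.orthonormal.1 j, Real.sqrt_sq (norm_nonneg _)]; simp
  have hF : Summable F := by
    refine Summable.of_norm ((summable_prod_of_nonneg fun _ => norm_nonneg _).2
      ⟨fun j => (hrow j).summable.norm, ?_⟩)
    exact hs.of_nonneg_of_le (fun j => tsum_nonneg fun i => norm_nonneg _) hbound
  have h1 := hF.hasSum.prod_fiberwise hrow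
  have h2 := ((Equiv.prodComm ι κ).hasSum_iff.2 hF.hasSum).prod_fiberwise hcol
  rw [h1.tsum_eq]
  exact h2

end HilbertBasis

/-! ### Trace class operators -/

section TraceClass

variable {H : Type u} [NormedAddCommGroup H] [InnerProductSpace ℂ H]

theorem isCompactOperator_of_finiteDimensional_range {C : H →L[ℂ] H}
    (hC : FiniteDimensional ℂ (LinearMap.range (C : H →ₗ[ℂ] H))) : IsCompactOperator C := by
  have : ProperSpace (LinearMap.range (C : H →ₗ[ℂ] H)) := FiniteDimensional.proper ℂ _
  let C' : H →L[ℂ] LinearMap.range (C : H →ₗ[ℂ] H) := C.codRestrict _ fun x => ⟨x, rfl⟩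
  exact (isCompactOperator_of_locallyCompactSpace_dom C').clm_comp
    (Submodule.subtypeL (LinearMap.range (C : H →ₗ[ℂ] H)))

variable [CompleteSpace H]

theorem abs_apply_abs_apply (C : H →L[ℂ] H) (x : H) :
    CFC.abs C (CFC.abs C x) = ContinuousLinearMap.adjoint C (C x) :=
  DFunLike.congr_fun (CFC.abs_mul_abs C) x

theorem isPositive_abs (C : H →L[ℂ] H) : (CFC.abs C).IsPositive :=
  (ContinuousLinearMap.nonneg_iff_isPositive _).1 (CFC.abs_nonneg C)

theorem norm_abs_apply (C : H →L[ℂ] H) (x : H) : ‖CFC.abs C x‖ = ‖C x‖ := by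
  have h : inner ℂ (CFC.abs C x) (CFC.abs C x) = inner ℂ (C x) (C x) := by
    rw [← (isPositive_abs C).isSymmetric.apply_clm, abs_apply_abs_apply,
      ContinuousLinearMap.adjoint_inner_left]
  rw [inner_self_eq_norm_sq_to_K, inner_self_eq_norm_sq_to_K] at h
  have h' : ‖CFC.abs C x‖ ^ 2 = ‖C x‖ ^ 2 := by exact_mod_cast h
  exact (sq_eq_sq₀ (norm_nonneg _) (norm_nonneg _)).1 h'

/-- A unit eigenvector `x` of `C* C` is an eigenvector of `|C|` for the singular value `‖C x‖`:
`|C| + ‖C x‖` is injective unless `C x = 0`, and `(|C| + ‖C x‖) (|C| - ‖C x‖) x = 0`. -/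
theorem abs_apply_of_adjoint_comp_apply_eq_smul {C : H →L[ℂ] H} {x : H} (hx : ‖x‖ = 1) {μ : ℂ}
    (h : ContinuousLinearMap.adjoint C (C x) = μ • x) : CFC.abs C x = (‖C x‖ : ℂ) • x := by
  have hμ : μ = (‖C x‖ : ℂ) ^ 2 := by
    have h1 : inner ℂ x (ContinuousLinearMap.adjoint C (C x)) = inner ℂ x (μ • x) := by rw [h]
    rw [ContinuousLinearMap.adjoint_inner_right, inner_smul_right, inner_self_eq_norm_sq_to_K,
      inner_self_eq_norm_sq_to_K, hx] at h1
    simpa using h1.symm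
  rcases eq_or_ne (C x) 0 with h0 | h0
  · have := norm_abs_apply C x
    rw [h0, norm_zero, norm_eq_zero] at this
    simp [this, h0]
  · set s := ‖C x‖
    have hs : 0 < s := norm_pos_iff.2 h0
    set y := CFC.abs C x - (s : ℂ) • x with hy
    have h2 : CFC.abs C y = -(s : ℂ) • y := by
      rw [hy, map_sub, map_smul, abs_apply_abs_apply, h, hμ]
      module
    have h3 := (isPositive_abs C).inner_nonneg_right y
    rw [h2, inner_smul_right, inner_self_eq_norm_sq_to_K] at h3
    have h4 : 0 ≤ -s * ‖y‖ ^ 2 := by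
      rw [← Complex.zero_le_real]
      simpa using h3
    have h5 : ‖y‖ = 0 := by
      by_contra hne
      have : 0 < ‖y‖ ^ 2 := by positivity
      nlinarith
    exact sub_eq_zero.1 (norm_eq_zero.1 h5)

theorem exists_hilbertBasis_eigenvectors {T : H →L[ℂ] H} (hT : IsCompactOperator T)
    (hT' : (T : H →ₗ[ℂ] H).IsSymmetric) :
    ∃ (κ : Type u) (e : HilbertBasis κ ℂ H), ∀ j, ∃ μ : ℂ, T (e j) = μ • e j := by
  have hc (μ : ℂ) : CompleteSpace (Module.End.eigenspace (T : Module.End ℂ H) μ) := by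
    have : IsClosed (Module.End.eigenspace (T : Module.End ℂ H) μ : Set H) := by
      convert isClosed_eq T.continuous (continuous_const_smul μ) using 1
      ext x
      exact Module.End.mem_eigenspace_iff
    exact this.completeSpace_coe
  obtain ⟨κ, c, b, hb⟩ := exists_hilbertBasis_sigma _ hT'.orthogonalFamily_eigenspaces
    (T.orthogonalComplement_iSup_eigenspaces_eq_bot hT hT')
  refine ⟨_, b, fun a => ⟨a.1, ?_⟩⟩
  rw [hb]
  exact Module.End.mem_eigenspace_iff.1 (c a.1 a.2).2

theorem IsTraceClass.exists_hasTrace {C : H →L[ℂ] H} (hC : IsTraceClass C) :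
    ∃ t, HasTrace C t := by
  have hT : IsCompactOperator (ContinuousLinearMap.adjoint C ∘L C) :=
    hC.1.clm_comp (ContinuousLinearMap.adjoint C)
  obtain ⟨κ, e, he⟩ := exists_hilbertBasis_eigenvectors hT
    (ContinuousLinearMap.isPositive_adjoint_comp_self C).isSymmetric
  refine exists_hasTrace_of_summable_norm e ?_
  have hs := (hC.2 κ e).norm
  refine hs.congr fun j => ?_
  obtain ⟨μ, hμ⟩ := he j
  rw [abs_apply_of_adjoint_comp_apply_eq_smul (e.orthonormal.1 j) hμ, inner_smul_right,
    inner_self_eq_norm_sq_to_K, e.orthonormal.1 j]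
  simp

/-- If `C` has finite rank then so has `|C|`, as the kernels agree. Expanding `|C| b_i` in an
orthonormal basis of the range of `|C|` turns the diagonal sum into finitely many series
`∑ ⟨x, b_i⟩ ⟨b_i, y⟩`. -/
theorem isTraceClass_of_finiteDimensional_range {C : H →L[ℂ] H}
    (hC : FiniteDimensional ℂ (LinearMap.range (C : H →ₗ[ℂ] H))) : IsTraceClass C := by
  refine ⟨isCompactOperator_of_finiteDimensional_range hC, fun ι b => ?_⟩
  set A := CFC.abs C with hA
  have hker : LinearMap.ker (A : H →ₗ[ℂ] H) = LinearMap.ker (C : H →ₗ[ℂ] H) := by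
    ext x
    simp only [LinearMap.mem_ker, ContinuousLinearMap.coe_coe]
    rw [← norm_eq_zero, hA, norm_abs_apply, norm_eq_zero]
  have hfin : FiniteDimensional ℂ (LinearMap.range (A : H →ₗ[ℂ] H)) :=
    ((C : H →ₗ[ℂ] H).quotKerEquivRange.symm.trans ((Submodule.quotEquivOfEq _ _ hker.symm).trans
      (A : H →ₗ[ℂ] H).quotKerEquivRange)).finiteDimensional
  let o := stdOrthonormalBasis ℂ (LinearMap.range (A : H →ₗ[ℂ] H))
  have hsum : Summable fun i => ∑ j, inner ℂ (A (o j)) (b i) * inner ℂ (b i) (o j : H) :=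
    summable_sum fun j _ => b.summable_inner_mul_inner _ _
  refine hsum.congr fun i => ?_
  have h1 := congrArg (fun z : LinearMap.range (A : H →ₗ[ℂ] H) => inner ℂ (b i) (z : H))
    (o.sum_repr' ⟨A (b i), b i, rfl⟩)
  simp only [Submodule.coe_sum, Submodule.coe_smul, inner_sum, inner_smul_right,
    Submodule.coe_inner] at h1
  rw [← h1]
  refine Finset.sum_congr rfl fun j _ => ?_
  rw [(isPositive_abs C).isSymmetric.apply_clm]

end TraceClass

/-! ### The trace of a finite potent trace class operator -/

section FinitePotentTraceClass

variable {H : Type u} [NormedAddCommGroup H] [InnerProductSpace ℂ H]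

/-- The diagonal sum of `C` over an orthonormal basis of `Uᗮ` is the trace of the compression of
`C` to `Uᗮ`, which is conjugate to the endomorphism of `H ⧸ U` induced by `C`. -/
theorem trace_mapQ_eq_sum_inner (C : H →ₗ[ℂ] H) (U : Submodule ℂ H) [U.HasOrthogonalProjection]
    (hU : ∀ x ∈ U, C x ∈ U) {κ : Type*} [Fintype κ] (b : OrthonormalBasis κ ℂ Uᗮ) :
    LinearMap.trace ℂ (H ⧸ U) (U.mapQ U C hU) = ∑ j, inner ℂ (b j : H) (C (b j)) := by
  let e := U.quotientEquivOfIsCompl Uᗮ U.isCompl_orthogonal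
  let T : Uᗮ →ₗ[ℂ] Uᗮ := (Uᗮ.orthogonalProjectionOnto : H →ₗ[ℂ] Uᗮ) ∘ₗ C ∘ₗ Uᗮ.subtype
  have h : e.symm.conj T = U.mapQ U C hU := by
    apply LinearMap.ext
    intro z
    obtain ⟨x, rfl⟩ := e.symm.surjective z
    rw [LinearEquiv.conj_apply_apply, LinearEquiv.symm_symm, LinearEquiv.apply_symm_apply]
    simp only [e, Submodule.quotientEquivOfIsCompl_symm_apply]
    refine (Submodule.Quotient.eq U).2 ?_
    have := Submodule.sub_starProjection_mem_orthogonal (K := Uᗮ) (C x)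
    rw [Submodule.orthogonal_orthogonal] at this
    rw [← neg_sub]
    exact neg_mem this
  rw [← h, LinearMap.trace_conj', LinearMap.trace_eq_sum_inner T b]
  refine Finset.sum_congr rfl fun j _ => ?_
  exact Submodule.inner_orthogonalProjectionOnto_eq_of_mem_left (b j) (C (b j))

variable [CompleteSpace H]

/-- In an orthonormal basis adapted to the flag `0 ≤ ker C ≤ ker C ^ 2 ≤ ⋯ ≤ N(C) ≤ H`, the
diagonal entries of `C` at the vectors in `N(C)` vanish, so that the diagonal sum is the
trace on `H ⧸ N(C)`. -/
theorem exists_hilbertBasis_hasSum_coreTrace {C : H →L[ℂ] H}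
    (hC : IsFinitePotent (C : H →ₗ[ℂ] H)) :
    ∃ (ι : Type u) (b : HilbertBasis ι ℂ H),
      HasSum (fun i => inner ℂ (b i) (C (b i))) (coreTrace (C : H →ₗ[ℂ] H)) := by
  obtain ⟨n, q, hq, hnq⟩ := hC.exists_aeval_eq_zero
  set U := nilSubspace (C : H →ₗ[ℂ] H) with hU
  let K : ℕ → Submodule ℂ H := fun m => LinearMap.ker ((C ^ m : H →L[ℂ] H) : H →ₗ[ℂ] H)
  have hKmem (m : ℕ) (x : H) : x ∈ K m ↔ ((C : H →ₗ[ℂ] H) ^ m) x = 0 := by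
    rw [← ContinuousLinearMap.toLinearMap_pow]; rfl
  have hKc (m : ℕ) : CompleteSpace (K m) :=
    (ContinuousLinearMap.isClosed_ker (C ^ m)).completeSpace_coe
  have hKU (m : ℕ) : K m ≤ U := fun x hx => ⟨m, (hKmem m x).1 hx⟩
  have hUK : U = K n := by
    ext x
    rw [hKmem, hU, nilSubspace_eq_ker_pow hq hnq, LinearMap.mem_ker]
  have hUc : CompleteSpace U := hUK ▸ hKc n
  have hstep (m : ℕ) {x : H} (hx : x ∈ K (m + 1)) : C x ∈ K m := by
    rw [hKmem] at hx ⊢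
    rwa [pow_succ] at hx
  have hmono : Monotone K := monotone_nat_of_le_succ fun m x hx => by
    rw [hKmem] at hx ⊢
    rw [pow_succ', Module.End.mul_apply, hx, map_zero]
  -- `none` labels the complement of `N(C)`, and `some m` the step from `ker C ^ m` to
  -- `ker C ^ (m + 1)` of the flag; the steps with `m ≥ n` are zero.
  let F : Option ℕ → Submodule ℂ H := fun o => o.elim Uᗮ fun m => K (m + 1) ⊓ (K m)ᗮ
  have hFc (o : Option ℕ) : CompleteSpace (F o) := by
    cases o with
    | none => exact (Submodule.isClosed_orthogonal U).completeSpace_coe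
    | some m =>
      exact ((ContinuousLinearMap.isClosed_ker (C ^ (m + 1))).inter
        (Submodule.isClosed_orthogonal (K m))).completeSpace_coe
  have hlt {l m : ℕ} (hlm : l < m) : F (some l) ⟂ F (some m) :=
    (Submodule.isOrtho_orthogonal_right (K m)).mono (inf_le_left.trans (hmono hlm)) inf_le_right
  have hnone (m : ℕ) : F (some m) ⟂ F none :=
    (Submodule.isOrtho_orthogonal_right U).mono_left (inf_le_left.trans (hKU _))
  have hF : OrthogonalFamily ℂ (fun o => F o) fun o => (F o).subtypeₗᵢ := by
    refine OrthogonalFamily.of_pairwise fun o o' hne => ?_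
    match o, o', hne with
    | none, some m, _ => exact (hnone m).symm
    | some m, none, _ => exact hnone m
    | some l, some m, hne =>
      rcases lt_or_gt_of_ne fun h : l = m => hne (congrArg some h) with h | h
      · exact hlt h
      · exact (hlt h).symm
    | none, none, hne => exact absurd rfl hne
  have hKF (m : ℕ) : K m ≤ ⨆ o, F o := by
    induction m with
    | zero =>
      intro x hx
      rw [hKmem] at hx
      have : x = 0 := hx
      exact this ▸ zero_mem _
    | succ m ih =>
      rw [← Submodule.sup_orthogonal_inf_of_hasOrthogonalProjection (hmono m.le_succ), inf_comm]
      exact sup_le ih (le_iSup F (some m))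
  have htop : (⨆ o, F o) = ⊤ := by
    rw [eq_top_iff, ← Submodule.sup_orthogonal_of_hasOrthogonalProjection (K := U)]
    exact sup_le (hUK ▸ hKF n) (le_iSup F none)
  obtain ⟨κ, c, b, hb⟩ := exists_hilbertBasis_sigma F hF
    (by rw [htop, Submodule.top_orthogonal_eq_bot])
  refine ⟨_, b, ?_⟩
  obtain ⟨hfin, htr⟩ := hC.hasLerayTrace
  have hUfin : FiniteDimensional ℂ (F none) :=
    (U.quotientEquivOfIsCompl Uᗮ U.isCompl_orthogonal).finiteDimensional
  have : Finite (κ none) := (c none).orthonormal.linearIndependent.finite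
  have := Fintype.ofFinite (κ none)
  rw [← (sigma_mk_injective (i := none)).hasSum_iff, ← htr]
  · let c₀ : HilbertBasis (κ none) ℂ Uᗮ := c none
    have h1 := trace_mapQ_eq_sum_inner (C : H →ₗ[ℂ] H) U (nilSubspace_invariant _)
      c₀.toOrthonormalBasis
    rw [HilbertBasis.coe_toOrthonormalBasis] at h1
    rw [lerayQuotientMap, h1]
    convert hasSum_fintype _ using 1
    refine Finset.sum_congr rfl fun j _ => ?_
    simp only [Function.comp_apply, hb]
    rfl
  · rintro ⟨o, j⟩ hj
    cases o with
    | none => exact absurd ⟨j, rfl⟩ hj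
    | some m =>
      -- `C` maps `ker C ^ (m + 1)` into `ker C ^ m`, to which the basis vector is orthogonal.
      rw [hb]
      exact Submodule.inner_left_of_mem_orthogonal (hstep m (c (some m) j).2.1)
        (c (some m) j).2.2

theorem IsTraceClass.hasTrace_coreTrace {C : H →L[ℂ] H} (hC : IsTraceClass C)
    (hC' : IsFinitePotent (C : H →ₗ[ℂ] H)) : HasTrace C (coreTrace (C : H →ₗ[ℂ] H)) := by
  obtain ⟨t, ht⟩ := hC.exists_hasTrace
  obtain ⟨ι, b, hb⟩ := exists_hilbertBasis_hasSum_coreTrace hC'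
  rwa [← (ht ι b).unique hb]

end FinitePotentTraceClass

/-! ### Finite potent operators are Riesz operators -/

section Riesz

variable {E : Type u} [NormedAddCommGroup E] [NormedSpace ℂ E]

theorem toLinearMap_aeval (T : E →L[ℂ] E) (p : ℂ[X]) :
    ((aeval T p : E →L[ℂ] E) : E →ₗ[ℂ] E) = aeval (T : Module.End ℂ E) p := by
  induction p using Polynomial.induction_on' with
  | add p q hp hq => rw [map_add, map_add, ContinuousLinearMap.toLinearMap_add, hp, hq]
  | monomial n a =>
    ext x
    simp [aeval_monomial, Algebra.algebraMap_eq_smul_one, ← ContinuousLinearMap.toLinearMap_pow]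

theorem aeval_clm_apply (T : E →L[ℂ] E) (p : ℂ[X]) (x : E) :
    (aeval T p : E →L[ℂ] E) x = aeval (T : Module.End ℂ E) p x :=
  DFunLike.congr_fun (toLinearMap_aeval T p) x

theorem aeval_mem_ker_aeval {f : Module.End ℂ E} (p r : ℂ[X]) {x : E}
    (hx : x ∈ LinearMap.ker (aeval f r)) : aeval f p x ∈ LinearMap.ker (aeval f r) := by
  rw [LinearMap.mem_ker] at hx ⊢
  rw [← Module.End.mul_apply, ← map_mul, mul_comm, map_mul, Module.End.mul_apply, hx, map_zero]

/-- Split the annihilating polynomial as `(X - z) ^ m * r` with `r` coprime to `X - z`. The kernels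
of the two factors decompose `E`; both are closed, the first lies in the finite-dimensional
`coreSubspace`, and on the second a Bézout coefficient inverts `T - z`. -/
theorem isRieszOperator_of_isFinitePotent {T : E →L[ℂ] E}
    (hT : IsFinitePotent (T : E →ₗ[ℂ] E)) : IsRieszOperator T := by
  intro z hz hz0
  obtain ⟨n, q, hq, h⟩ := hT.exists_aeval_eq_zero
  have hq0 : X ^ n * q ≠ 0 := by
    refine mul_ne_zero (pow_ne_zero _ X_ne_zero) ?_
    rintro rfl
    exact not_isUnit_X (isCoprime_zero_left.1 hq)
  obtain ⟨r, hr, hd⟩ := (X ^ n * q).exists_eq_pow_rootMultiplicity_mul_and_not_dvd hq0 z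
  set m := (X ^ n * q).rootMultiplicity z
  have hcop : IsCoprime (X - C z) r := ((irreducible_X_sub_C z).coprime_iff_not_dvd).2 hd
  set f : Module.End ℂ E := (T : E →ₗ[ℂ] E)
  have hinv (p : ℂ[X]) : ∀ x ∈ LinearMap.ker (aeval f p), T x ∈ LinearMap.ker (aeval f p) := by
    intro x hx
    simpa [f] using aeval_mem_ker_aeval X p hx
  have hsub (x : E) : aeval f (X - C z) x = T x - z • x := by
    simp [f, Module.algebraMap_end_eq_smul_id]
  refine ⟨hz, LinearMap.ker (aeval f ((X - C z) ^ m)), LinearMap.ker (aeval f r), ⟨?_, ?_⟩,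
    hinv _, hinv _, ?_, ?_, ⟨m, ?_⟩, ?_⟩
  · exact disjoint_ker_aeval_of_isCoprime f hcop.pow_left
  · rw [codisjoint_iff, sup_ker_aeval_eq_ker_aeval_mul_of_coprime f hcop.pow_left, ← hr, h,
      LinearMap.ker_zero]
  · have := hT.finiteDimensional_coreSubspace
    refine Submodule.finiteDimensional_of_le (S₂ := coreSubspace f) fun x hx => ⟨_, ?_, hx⟩
    refine IsCoprime.pow_left ?_
    simpa using isCoprime_X_sub_C_of_isUnit_sub (R := ℂ) (a := z) (b := 0) (by simpa using hz0)
  · rw [← toLinearMap_aeval]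
    exact ContinuousLinearMap.isClosed_ker _
  · intro x hx
    have h1 : T - z • ContinuousLinearMap.id ℂ E = aeval T (X - C z) := by
      rw [map_sub, aeval_X, aeval_C, Algebra.algebraMap_eq_smul_one]; rfl
    rw [h1, ← map_pow, aeval_clm_apply]
    exact hx
  · obtain ⟨b, a, hab⟩ := hcop
    have hid (x : LinearMap.ker (aeval f r)) : aeval f (b * (X - C z)) x = x := by
      have h1 := congrArg (fun p => aeval f p (x : E)) hab
      have h2 : aeval f r (x : E) = 0 := x.2
      simpa [Module.End.mul_apply, h2] using h1
    refine ⟨{ toFun := fun x => ⟨aeval f (X - C z) x, aeval_mem_ker_aeval _ _ x.2⟩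
              invFun := fun x => ⟨aeval f b x, aeval_mem_ker_aeval _ _ x.2⟩
              left_inv := fun x => Subtype.ext ?_
              right_inv := fun x => Subtype.ext ?_
              continuous_toFun := ?_
              continuous_invFun := ?_ }, fun x => hsub x⟩
    · change aeval f b (aeval f (X - C z) (x : E)) = x
      rw [← Module.End.mul_apply, ← map_mul, hid]
    · change aeval f (X - C z) (aeval f b (x : E)) = x
      rw [← Module.End.mul_apply, ← map_mul, mul_comm, hid]
    · simp only [f, ← aeval_clm_apply]
      exact ((aeval T (X - C z) : E →L[ℂ] E).continuous.comp continuous_subtype_val).subtype_mk _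
    · simp only [f, ← aeval_clm_apply]
      exact ((aeval T b : E →L[ℂ] E).continuous.comp continuous_subtype_val).subtype_mk _

end Riesz

/-! ### West decompositions -/

section West

variable {E : Type u} [NormedAddCommGroup E] [NormedSpace ℂ E]

theorem isQuasinilpotent_of_isNilpotent {Q : E →L[ℂ] E} (hQ : IsNilpotent Q) :
    IsQuasinilpotent Q := by
  intro z hz
  by_contra hz0
  refine hz ?_
  rw [spectrum.mem_resolventSet_iff, sub_eq_add_neg]
  exact hQ.neg.isUnit_add_left_of_commute ((Ne.isUnit hz0).map (algebraMap ℂ (E →L[ℂ] E)))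
    (Algebra.commutes z (-Q)).symm

/-- A non-zero core of `Q` would contain an eigenvector of `Q` for a non-zero eigenvalue. -/
theorem IsFinitePotent.isNilpotent_of_isQuasinilpotent {Q : E →L[ℂ] E}
    (hf : IsFinitePotent (Q : E →ₗ[ℂ] E)) (hQ : IsQuasinilpotent Q) :
    IsNilpotent (Q : Module.End ℂ E) := by
  have hcore : coreSubspace (Q : Module.End ℂ E) = ⊥ := by
    by_contra hne
    have := Submodule.nontrivial_iff_ne_bot.2 hne
    have := hf.finiteDimensional_coreSubspace
    obtain ⟨μ, hμ⟩ := Module.End.exists_eigenvalue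
      ((Q : Module.End ℂ E).restrict (coreSubspace_invariant (Q : Module.End ℂ E)))
    obtain ⟨x, hx, hx0⟩ := hμ.exists_hasEigenvector
    rw [Module.End.mem_eigenspace_iff] at hx
    have hx' : Q x = μ • (x : E) := congrArg Subtype.val hx
    have hμ0 : μ ≠ 0 := by
      rintro rfl
      rw [zero_smul] at hx
      exact hx0 (injective_restrict_coreSubspace _ (hx.trans (map_zero _).symm))
    refine hμ0 (hQ (a := μ) fun hu => hx0 ?_)
    obtain ⟨R, hR⟩ := hu.exists_left_inv
    have h1 := DFunLike.congr_fun hR (x : E)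
    simp [hx', Algebra.algebraMap_eq_smul_one] at h1
    exact Subtype.ext h1.symm
  obtain ⟨n, q, hq, h⟩ := hf.exists_aeval_eq_zero
  have hnil := hf.isCompl.sup_eq_top
  rw [hcore, bot_sup_eq, nilSubspace_eq_ker_pow hq h, LinearMap.ker_eq_top] at hnil
  exact ⟨n, hnil⟩

end West

section Hilbert

variable {H : Type u} [NormedAddCommGroup H] [InnerProductSpace ℂ H] [CompleteSpace H]

/-- From a Bézout identity `a q + b X ^ n = 1` the polynomial `b X ^ n` gives the projection onto
`W_φ` along `U_φ`, and `C = φ P`, `Q = φ (1 - P)` is a West decomposition. -/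
theorem exists_isWestDecomposition {φ : H →L[ℂ] H} (hφ : IsFinitePotent (φ : H →ₗ[ℂ] H)) :
    ∃ C Q : H →L[ℂ] H, IsWestDecomposition φ C Q ∧ IsTraceClass C := by
  obtain ⟨n, q, hq, h⟩ := hφ.exists_aeval_eq_zero
  obtain ⟨a, b, hab⟩ := hq.pow_right (n := n)
  have h0 (p : ℂ[X]) : aeval φ (p * (X ^ n * q)) = (0 : H →L[ℂ] H) := by
    ext x
    rw [aeval_clm_apply, map_mul, h, mul_zero]
    rfl
  have hfin : FiniteDimensional ℂ
      (LinearMap.range ((aeval φ (X * (b * X ^ n)) : H →L[ℂ] H) : H →ₗ[ℂ] H)) := by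
    have := hφ.finiteDimensional_coreSubspace
    refine Submodule.finiteDimensional_of_le (S₂ := coreSubspace (φ : H →ₗ[ℂ] H)) ?_
    rintro _ ⟨x, rfl⟩
    refine ⟨q, hq, ?_⟩
    rw [toLinearMap_aeval, ← Module.End.mul_apply, ← map_mul, ← toLinearMap_aeval,
      show q * (X * (b * X ^ n)) = X * b * (X ^ n * q) by ring, h0]
    rfl
  refine ⟨aeval φ (X * (b * X ^ n)), aeval φ (X * (a * q)), ⟨?_, ?_, ?_, ?_, ?_⟩,
    isTraceClass_of_finiteDimensional_range hfin⟩
  · rw [← map_add, ← mul_add, add_comm, hab, mul_one, aeval_X]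
  · exact isCompactOperator_of_finiteDimensional_range hfin
  · refine isQuasinilpotent_of_isNilpotent ⟨n + 1, ?_⟩
    rw [← map_pow, show (X * (a * q)) ^ (n + 1) = X * a ^ (n + 1) * q ^ n * (X ^ n * q) by ring, h0]
  · change aeval φ _ * aeval φ _ = 0
    rw [← map_mul, show X * (b * X ^ n) * (X * (a * q)) = X * b * (X * a) * (X ^ n * q) by ring, h0]
  · change aeval φ _ * aeval φ _ = 0
    rw [← map_mul, show X * (a * q) * (X * (b * X ^ n)) = X * b * (X * a) * (X ^ n * q) by ring, h0]

/-- In any West decomposition `φ = C + Q` of a finite potent operator, `C` and `Q` are finite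
potent; `Q`, being also quasinilpotent, is nilpotent, and `C` and `φ` have the same core trace. -/
theorem IsWestDecomposition.hasTrace {φ C Q : H →L[ℂ] H} (hφ : IsFinitePotent (φ : H →ₗ[ℂ] H))
    (h : IsWestDecomposition φ C Q) (hC : IsTraceClass C) :
    HasTrace C (coreTrace (φ : H →ₗ[ℂ] H)) := by
  have hCQ : (C : Module.End ℂ H) * (Q : Module.End ℂ H) = 0 :=
    congrArg ContinuousLinearMap.toLinearMap h.comp_left
  have hQC : (Q : Module.End ℂ H) * (C : Module.End ℂ H) = 0 :=
    congrArg ContinuousLinearMap.toLinearMap h.comp_right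
  have hadd : (φ : Module.End ℂ H) = (C : Module.End ℂ H) + (Q : Module.End ℂ H) :=
    congrArg ContinuousLinearMap.toLinearMap h.eq_add
  rw [hadd] at hφ ⊢
  have hCf := hφ.of_add hCQ
  have hQf := (add_comm (C : Module.End ℂ H) _ ▸ hφ).of_add hQC
  rw [coreTrace_add_eq hQC (hQf.isNilpotent_of_isQuasinilpotent h.quasinilpotent)]
  exact hC.hasTrace_coreTrace hCf

theorem IsFinitePotent.hasRieszTrace {φ : H →L[ℂ] H} (hφ : IsFinitePotent (φ : H →ₗ[ℂ] H)) :
    HasRieszTrace φ (coreTrace (φ : H →ₗ[ℂ] H)) :=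
  ⟨⟨isRieszOperator_of_isFinitePotent hφ, exists_isWestDecomposition hφ⟩,
    fun _ _ h hC => h.hasTrace hφ hC⟩

end Hilbert

end FinPotent

theorem theorem3p25 {H : Type*} [NormedAddCommGroup H] [InnerProductSpace ℂ H] [CompleteSpace H]
    (φ : H →L[ℂ] H) (hφ : FinPotent.IsFinitePotent (φ : H →ₗ[ℂ] H)) :
    FinPotent.IsASTDecomposition (φ : H →ₗ[ℂ] H)
      (FinPotent.coreSubspace (φ : H →ₗ[ℂ] H)) (FinPotent.nilSubspace (φ : H →ₗ[ℂ] H)) ∧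
    ∀ (W U : Submodule ℂ H) (hAST : FinPotent.IsASTDecomposition (φ : H →ₗ[ℂ] H) W U),
      W = FinPotent.coreSubspace (φ : H →ₗ[ℂ] H) ∧
      U = FinPotent.nilSubspace (φ : H →ₗ[ℂ] H) ∧
      ∃ t : ℂ,
        FinPotent.HasTateTrace (φ : H →ₗ[ℂ] H) t ∧
        FinPotent.HasRieszTrace φ t ∧
        FinPotent.HasLerayTrace (φ : H →ₗ[ℂ] H) t ∧
        LinearMap.trace ℂ W (LinearMap.restrict (φ : H →ₗ[ℂ] H) hAST.invariant_left) = t :=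
  ⟨hφ.isASTDecomposition, fun _ _ hAST => ⟨hAST.left_eq, hAST.right_eq, _, hφ.hasTateTrace,
    hφ.hasRieszTrace, hφ.hasLerayTrace,
    FinPotent.trace_restrict_congr hAST.left_eq _ _ fun _ _ => rfl⟩⟩
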